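/- Let $M$ be a Poisson manifold, that is, a smooth (Hausdorff, second countable) real manifold whose algebra $C^\infty(M)$ of smooth functions (real- or complex-valued; linear means linear over $\mathbb{K}=\mathbb{R}$ or $\mathbb{C}$ accordingly) carries a $\mathbb{K}$-bilinear Lie bracket $\{\cdot,\cdot\}$ which is a derivation in each argument. A $k$-differential operator is a $\mathbb{K}$-multilinear map $C^\infty(M)^k\to C^\infty(M)$ that is a differential operator of finite order in each argument (for $k=0$, an element of $C^\infty(M)$). An $n$-element family $C_0,\dots,C_{n-1}$, with $C_k$ a $k$-differential operator, is called coherent if (A) each $C_k$ with $k\ge 1$ is a derivation in its first argument, and (B) for all $m\le n-1$ and $1\le k\le m-1$ and all $f_1,\dots,f_m\in C^\infty(M)$, $$C_m(f_1,\dots,f_k,f_{k+1},\dots,f_m)-C_m(f_1,\dots,f_{k+1},f_k,\dots,f_m)=C_{m-1}(f_1,\dots,\{f_k,f_{k+1}\},\dots,f_m).$$ **Theorem.** For every $n\ge 0$, any $n$-element coherent family $\{C_k\}$, $0\le k\le n-1$, on $M$ can be extended by an $n$-differential operator $C_n$ to an $(n+1)$-element coherent family $\{C_k\}$, $0\le k\le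 n$. The operator $C_n$ is unique up to an arbitrary symmetric multiderivation: if $C_n$ is one such extension, then an $n$-linear operator $C_n'$ also extends the family to a coherent one if and only if $C_n'-C_n$ is symmetric in all its arguments and a derivation in each of them. -/

import Mathlib

open scoped Manifold ContDiff

section Algebra

variable {𝕜 A : Type*} [CommRing 𝕜] [CommRing A] [Algebra 𝕜 A]

/-- A Poisson bracket on a commutative `𝕜`-algebra: a `𝕜`-bilinear Lie bracket which is a derivation
in each argument.  A Poisson manifold is a manifold with such a bracket on its smooth functions. -/
structure PoissonBracket (𝕜 A : Type*) [CommRing 𝕜] [CommRing A] [Algebra 𝕜 A] where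
  /-- the bracket `{f, g}` -/
  bracket : A →ₗ[𝕜] A →ₗ[𝕜] A
  bracket_self : ∀ f, bracket f f = 0
  jacobi : ∀ f g h, bracket f (bracket g h) + bracket g (bracket h f) + bracket h (bracket f g) = 0
  leibniz : ∀ f g h, bracket f (g * h) = bracket f g * h + g * bracket f h

/-- `D` is a linear differential operator of order at most `r` on the commutative algebra `A`:
an operator of order `0` is `A`-linear (multiplication by an element of `A`), and `D` has order at
most `r + 1` if its commutators with all multiplication operators have order at most `r`.
On the algebra of smooth functions of a manifold these are exactly the operators which, in every
chart, have the form `∑_{|α| ≤ r} a_α ∂^α` with smooth coefficients. -/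
def IsDiffOp : ℕ → (A →ₗ[𝕜] A) → Prop
  | 0, D => ∀ a f : A, D (a * f) = a * D f
  | r + 1, D => ∀ a : A, IsDiffOp r (D ∘ₗ LinearMap.mulLeft 𝕜 a - LinearMap.mulLeft 𝕜 a ∘ₗ D)

/-- `𝕜`-multilinear operators `A × ⋯ × A → A` with `n` arguments; for `n = 0` these are the
elements of `A`. -/
abbrev MultiOp (𝕜 A : Type*) [CommRing 𝕜] [CommRing A] [Algebra 𝕜 A] (n : ℕ) : Type _ :=
  MultilinearMap 𝕜 (fun _ : Fin n => A) A

/-- An `n`-differential (polydifferential) operator: an `n`-linear operator which is a differential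
operator of some finite order in each of its arguments. -/
def IsPolydifferential {n : ℕ} (C : MultiOp 𝕜 A n) : Prop :=
  ∃ r : ℕ, ∀ (i : Fin n) (v : Fin n → A), IsDiffOp r (C.toLinearMap v i)

/-- The operator `C` (linear in each argument) satisfies the Leibniz rule in its `i`-th argument. -/
def IsDerivationIn {n : ℕ} (C : MultiOp 𝕜 A n) (i : Fin n) : Prop :=
  ∀ (v : Fin n → A) (f g : A),
    C (Function.update v i (f * g)) =
      f * C (Function.update v i g) + g * C (Function.update v i f)

/-- A symmetric multiderivation: invariant under all permutations of the arguments and a derivation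
in each of them. -/
def IsSymmetricMultiderivation {n : ℕ} (S : MultiOp 𝕜 A n) : Prop :=
  (∀ (σ : Equiv.Perm (Fin n)) (v : Fin n → A), S (v ∘ σ) = S v) ∧ ∀ i, IsDerivationIn S i

namespace PoissonBracket

variable (P : PoissonBracket 𝕜 A)

/-- From `(f_0, …, f_m)` form `(f_0, …, {f_k, f_{k+1}}, …, f_m)`, which has `m` entries. -/
def contract {m : ℕ} (k : Fin m) (f : Fin (m + 1) → A) : Fin m → A := fun j =>
  if j < k then f j.castSucc
  else if j = k then P.bracket (f k.castSucc) (f k.succ)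
  else f j.succ

/-- An `n`-element coherent family `C_0, …, C_{n-1}`, where `C_k` has `k` arguments. -/
structure IsCoherent {n : ℕ} (C : ∀ k : Fin n, MultiOp 𝕜 A k) : Prop where
  polydifferential : ∀ k, IsPolydifferential (C k)
  /-- each operator is a derivation in its first argument -/
  derivation_first : ∀ (k : Fin n) (hk : 0 < (k : ℕ)), IsDerivationIn (C k) ⟨0, hk⟩
  /-- exchanging two adjacent arguments -/
  swap : ∀ (m : ℕ) (hm : m + 1 < n) (k : Fin m) (f : Fin (m + 1) → A),
    C ⟨m + 1, hm⟩ f - C ⟨m + 1, hm⟩ (f ∘ Equiv.swap k.castSucc k.succ) =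
      C ⟨m, (Nat.lt_succ_self m).trans hm⟩ (P.contract k f)

end PoissonBracket

/-- The family `C_0, …, C_{n-1}, D`. -/
def extendFamily {n : ℕ} (C : ∀ k : Fin n, MultiOp 𝕜 A k) (D : MultiOp 𝕜 A n) :
    ∀ k : Fin (n + 1), MultiOp 𝕜 A k :=
  Fin.snoc (α := fun k : Fin (n + 1) => MultiOp 𝕜 A k) C D

end Algebra

section Smooth

/-- Multiplication of `𝕜` (the real or the complex numbers) is smooth over `ℝ`. -/
instance instContMDiffRingRCLike {𝕜 : Type*} [RCLike 𝕜] : ContMDiffRing 𝓘(ℝ, 𝕜) ∞ 𝕜 where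
  __ := (inferInstance : LieAddGroup 𝓘(ℝ, 𝕜) ∞ 𝕜)
  contMDiff_mul := by
    have h1 : ContMDiff (𝓘(ℝ, 𝕜).prod 𝓘(ℝ, 𝕜)) 𝓘(ℝ, 𝕜 × 𝕜) ∞ (fun p : 𝕜 × 𝕜 => p) :=
      contMDiff_fst.prodMk_space contMDiff_snd
    have h2 : ContDiff ℝ ∞ (fun p : 𝕜 × 𝕜 => p.1 * p.2) := contDiff_fst.mul contDiff_snd
    exact h2.contMDiff.comp h1

/-- The smooth `𝕜`-valued functions on a real `d`-dimensional manifold `M`. -/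
abbrev SmoothFun (𝕜 : Type*) [RCLike 𝕜] (d : ℕ) (M : Type*) [TopologicalSpace M]
    [ChartedSpace (EuclideanSpace ℝ (Fin d)) M] : Type _ :=
  C^∞⟮𝓡 d, M; 𝓘(ℝ, 𝕜), 𝕜⟯

/-- The pointwise `𝕜`-algebra structure on smooth `𝕜`-valued functions. -/
noncomputable instance instAlgebraSmoothFun {𝕜 : Type*} [RCLike 𝕜] {d : ℕ} {M : Type*} [TopologicalSpace M]
    [ChartedSpace (EuclideanSpace ℝ (Fin d)) M] : Algebra 𝕜 (SmoothFun 𝕜 d M) where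
  smul c f := ⟨fun x => c • f x,
    (contMDiff_const (c := c) (I := 𝓡 d) (I' := 𝓘(ℝ, 𝕜)) (n := ∞)).mul f.contMDiff⟩
  algebraMap :=
    { toFun := fun c => ⟨fun _ => c, contMDiff_const⟩
      map_one' := rfl
      map_mul' := fun _ _ => rfl
      map_zero' := rfl
      map_add' := fun _ _ => rfl }
  commutes' c f := by ext x; exact mul_comm _ _
  smul_def' _ _ := rfl

end Smooth

/-! Write `Lifts B C` for the relation between consecutive members of a coherent family. Two lifts
of the same operator differ by something invariant under adjacent transpositions, hence under all
permutations, and a derivation in its first argument, hence in all: this is uniqueness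
(`Lifts.lifts_iff`). Finite order is automatic (`IsTop.isDiffOp`), so existence means finding a lift
`D` of the last operator `C`.

Existence goes by induction on the arity. Freezing the last argument of `C` at `x` gives the top of
a shorter coherent family, with a lift `G`, a candidate for `D(…, x)`. Carrying `x` to the front
adds terms `C(…, {x, f_k}, …)`, so `G` plus their sum is a candidate for `D(x, …)`
(`Lifts.isPartialLift`). It can be chosen linear in `x`, but need not be a derivation in `x`. An
`A`-linear retraction of `End A` onto the derivations, applied in the variable `x`, repairs this
without spoiling the other relations, whose right sides are already derivations in `x`
(`exists_isPreLift`).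

Only the exchange of the first two arguments may now fail. Its defect `R` is a derivation in its
first argument, antisymmetric in the first two, symmetric in the rest, and has vanishing cyclic
sums. Hence `R` is itself the antisymmetrization of an averaged operator `T`, and `D - T` is a lift
(`IsPreLift.exists_lifts`).

Geometry enters only through the retraction: send `H` to the operator that in charts is `∑ H(x^i)
∂_i`, glued by a partition of unity. It fixes derivations by Hadamard's lemma. -/

/-! ### Differential operators on a commutative algebra -/

section DiffOp

variable {𝕜 A : Type*} [CommRing 𝕜] [CommRing A] [Algebra 𝕜 A]

theorem IsDiffOp.zero (r : ℕ) : IsDiffOp r (0 : A →ₗ[𝕜] A) := by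
  induction r with
  | zero => intro a f; simp
  | succ r ih => intro a; simpa using ih

theorem IsDiffOp.add {r : ℕ} {D E : A →ₗ[𝕜] A} (hD : IsDiffOp r D) (hE : IsDiffOp r E) :
    IsDiffOp r (D + E) := by
  induction r generalizing D E with
  | zero => intro a f; simp [hD a f, hE a f, mul_add]
  | succ r ih =>
    intro a
    convert ih (hD a) (hE a) using 1
    ext f; simp; ring

theorem IsDiffOp.succ {r : ℕ} {D : A →ₗ[𝕜] A} (hD : IsDiffOp r D) : IsDiffOp (r + 1) D := by
  induction r generalizing D with
  | zero =>
    intro a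
    convert IsDiffOp.zero (𝕜 := 𝕜) (A := A) 0 using 1
    ext f; simp [hD a f]
  | succ r ih => intro a; exact ih (hD a)

theorem IsDiffOp.comp_mulLeft {r : ℕ} {D : A →ₗ[𝕜] A} (hD : IsDiffOp r D) (b : A) :
    IsDiffOp r (D ∘ₗ LinearMap.mulLeft 𝕜 b) := by
  induction r generalizing D with
  | zero => intro a f; simp [hD b, hD a f]; ring
  | succ r ih =>
    intro a
    convert ih (hD a) using 1
    ext f; simp [mul_left_comm]

/-- Precomposition with a derivation raises the order of a differential operator by at most one. -/
theorem IsDiffOp.comp_derivation {r : ℕ} {D δ : A →ₗ[𝕜] A} (hD : IsDiffOp r D)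
    (hδ : ∀ f g, δ (f * g) = f * δ g + g * δ f) : IsDiffOp (r + 1) (D ∘ₗ δ) := by
  induction r generalizing D with
  | zero =>
    intro a b f
    simp only [LinearMap.sub_apply, LinearMap.comp_apply, LinearMap.mulLeft_apply, hδ, map_add,
      hD _ _]
    ring
  | succ r ih =>
    intro a
    -- The commutator with multiplication is `[D ∘ δ, a] = [D, a] ∘ δ + D ∘ (δ a)`.
    convert (ih (hD a)).add (hD.comp_mulLeft (δ a)) using 1
    ext f
    simp [hδ, mul_comm f]
    ring

theorem isDiffOp_one_of_derivation {δ : A →ₗ[𝕜] A}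
    (hδ : ∀ f g, δ (f * g) = f * δ g + g * δ f) : IsDiffOp 1 δ :=
  IsDiffOp.comp_derivation (D := LinearMap.id) (fun _ _ => rfl) hδ

theorem IsDiffOp.mono {r s : ℕ} (h : r ≤ s) {D : A →ₗ[𝕜] A} (hD : IsDiffOp r D) :
    IsDiffOp s D := Nat.le_induction hD (fun _ _ => IsDiffOp.succ) s h

end DiffOp

/-! ### Lifts, contraction of adjacent arguments, and automatic finite order -/

section Lifts

theorem update_perm_comp {α : Type*} {m : ℕ} (σ : Equiv.Perm (Fin m)) (v : Fin m → α) (i : Fin m)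
    (a : α) : Function.update v (σ i) a ∘ σ = Function.update (v ∘ σ) i a := by
  rw [Function.update_comp_equiv, Equiv.symm_apply_apply]

variable {𝕜 A : Type*} [CommRing 𝕜] [CommRing A] [Algebra 𝕜 A]

theorem isDerivationIn_zero_iff {m : ℕ} (D : MultiOp 𝕜 A (m + 1)) :
    IsDerivationIn D 0 ↔ ∀ (u : Fin m → A) (f g : A),
      D (Fin.cons (f * g) u) = f * D (Fin.cons g u) + g * D (Fin.cons f u) := by
  constructor
  · intro h u f g
    simpa using h (Fin.cons 0 u) f g
  · intro h v f g
    have h1 (a : A) : Function.update v 0 a = Fin.cons a (Fin.tail v) := by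
      conv_lhs => rw [← Fin.cons_self_tail v]
      exact Fin.update_cons_zero _ _ _
    simpa only [h1] using h (Fin.tail v) f g

namespace PoissonBracket

variable (P : PoissonBracket 𝕜 A)

theorem bracket_skew (f g : A) : P.bracket f g = -P.bracket g f := by
  have h := P.bracket_self (f + g)
  simp only [map_add, LinearMap.add_apply, P.bracket_self, zero_add, add_zero] at h
  exact eq_neg_of_add_eq_zero_right h

theorem leibniz_left (f g h : A) :
    P.bracket (f * g) h = f * P.bracket g h + g * P.bracket f h := by
  rw [bracket_skew, leibniz, bracket_skew P h f, bracket_skew P h g]; ring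

theorem leibniz_right (f g h : A) :
    P.bracket h (f * g) = f * P.bracket h g + g * P.bracket h f := by
  rw [leibniz]; ring

theorem bracket_bracket (x f g : A) :
    P.bracket x (P.bracket f g) = P.bracket (P.bracket x f) g + P.bracket f (P.bracket x g) := by
  have h := P.jacobi x f g
  rw [P.bracket_skew g x, P.bracket_skew g, map_neg] at h
  linear_combination h

theorem contract_cons_zero {m : ℕ} (f g : A) (u : Fin m → A) :
    P.contract 0 (Fin.cons f (Fin.cons g u)) = Fin.cons (P.bracket f g) u := by
  ext j
  refine Fin.cases ?_ (fun j => ?_) j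
  · simp [contract]
  · simp [contract]

theorem contract_cons_succ {m : ℕ} (k : Fin m) (f : A) (v : Fin (m + 1) → A) :
    P.contract k.succ (Fin.cons f v) = Fin.cons f (P.contract k v) := by
  ext j
  refine Fin.cases ?_ (fun j => ?_) j
  · simp [contract]
  · simp [contract]

theorem contract_snoc_castSucc {m : ℕ} (k : Fin m) (x : A) (v : Fin (m + 1) → A) :
    P.contract k.castSucc (Fin.snoc v x : Fin (m + 2) → A) =
      (Fin.snoc (P.contract k v) x : Fin (m + 1) → A) := by
  ext j
  refine Fin.lastCases ?_ (fun j => ?_) j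
  · have h1 : ¬ Fin.last m < k.castSucc := not_lt.2 (Fin.le_last _)
    have h2 : Fin.last m ≠ k.castSucc := (Fin.castSucc_lt_last k).ne'
    simp [contract, h1, h2]
  · simp only [contract, Fin.snoc_castSucc, Fin.succ_castSucc, Fin.castSucc_lt_castSucc_iff,
      Fin.castSucc_inj]

theorem contract_insertNth {m : ℕ} (p : Fin m) (x : A) (w : Fin m → A) :
    P.contract p (p.castSucc.insertNth x w) = Function.update w p (P.bracket x (w p)) := by
  ext j
  rcases lt_trichotomy j p with h | rfl | h
  · have h1 : p.castSucc.succAbove j = j.castSucc := Fin.succAbove_castSucc_of_lt _ _ h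
    have h2 := Fin.insertNth_apply_succAbove (α := fun _ => A) p.castSucc x w j
    rw [h1] at h2
    simp [contract, h, h.ne, h2]
  · have h2 := Fin.insertNth_apply_succAbove (α := fun _ => A) j.castSucc x w j
    rw [Fin.succAbove_castSucc_self] at h2
    simp [contract, h2]
  · have h1 : p.castSucc.succAbove j = j.succ := Fin.succAbove_castSucc_of_le _ _ h.le
    have h2 := Fin.insertNth_apply_succAbove (α := fun _ => A) p.castSucc x w j
    rw [h1] at h2
    simp [contract, h.not_gt, h.ne', h2]

/-- `D`, with one argument more than `B`, is a derivation in its first argument, and exchanging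
two adjacent arguments changes `D` by the value of `B` on the contracted arguments. -/
structure Lifts {m : ℕ} (B : MultiOp 𝕜 A m) (D : MultiOp 𝕜 A (m + 1)) : Prop where
  derivation_first : IsDerivationIn D 0
  swap : ∀ (k : Fin m) (v : Fin (m + 1) → A),
    D v - D (v ∘ Equiv.swap k.castSucc k.succ) = B (P.contract k v)

/-- `C` is the last operator of a coherent family. -/
def IsTop : ∀ {m : ℕ}, MultiOp 𝕜 A m → Prop
  | 0, _ => True
  | _ + 1, C => ∃ B, IsTop B ∧ P.Lifts B C

variable {P}

theorem contract_update_succ {m : ℕ} (k : Fin m) (v : Fin (m + 1) → A) (a : A) :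
    P.contract k (Function.update v k.succ a) =
      Function.update (P.contract k v) k (P.bracket (v k.castSucc) a) := by
  ext j
  rcases lt_trichotomy j k with h | rfl | h
  · have h1 : j.castSucc ≠ k.succ :=
      ((Fin.castSucc_lt_castSucc_iff.2 h).trans k.castSucc_lt_succ).ne
    simp [contract, h, h.ne, h1]
  · have h1 : j.castSucc ≠ j.succ := j.castSucc_lt_succ.ne
    simp [contract, h1]
  · have h1 : j.succ ≠ k.succ := by simpa using h.ne'
    simp [contract, h.not_gt, h.ne']

theorem contract_update_castSucc {m : ℕ} (k : Fin m) (v : Fin (m + 1) → A) (a : A) :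
    P.contract k (Function.update v k.castSucc a) =
      Function.update (P.contract k v) k (P.bracket a (v k.succ)) := by
  ext j
  rcases lt_trichotomy j k with h | rfl | h
  · have h1 : j.castSucc ≠ k.castSucc := by simpa using h.ne
    simp [contract, h, h.ne]
  · have h1 : j.succ ≠ j.castSucc := j.castSucc_lt_succ.ne'
    simp [contract, h1]
  · have h1 : j.succ ≠ k.castSucc := (lt_trans k.castSucc_lt_succ (Fin.succ_lt_succ_iff.2 h)).ne'
    simp [contract, h.not_gt, h.ne', h1]

/-- Operators at the end of a coherent family are automatically of finite order. -/
theorem IsTop.isDiffOp {m : ℕ} {C : MultiOp 𝕜 A m} (hC : P.IsTop C) (i : Fin m) (v : Fin m → A) :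
    IsDiffOp m (C.toLinearMap v i) := by
  induction m with
  | zero => exact i.elim0
  | succ m ih =>
    obtain ⟨B, hB, hBC⟩ := hC
    induction i using Fin.induction generalizing v with
    | zero =>
      refine (isDiffOp_one_of_derivation fun f g => ?_).mono (Nat.succ_pos m)
      exact hBC.derivation_first v f g
    | succ k ihk =>
      -- Exchanging with the previous argument expresses `C` in slot `k + 1` through `C` in slot `k`
      -- plus `B` in slot `k` composed with the derivation `{v_k, ·}`; the latter has order at most
      -- `m + 1`.
      have h := (ihk (v ∘ Equiv.swap k.castSucc k.succ)).add
        ((ih hB k (P.contract k v)).comp_derivation (δ := P.bracket (v k.castSucc))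
          fun f g => P.leibniz_right f g _)
      convert h using 1
      ext f
      have h1 := hBC.swap k (Function.update v k.succ f)
      have h2 := update_perm_comp (Equiv.swap k.castSucc k.succ) v k.castSucc f
      rw [Equiv.swap_apply_left] at h2
      rw [contract_update_succ, h2] at h1
      simpa [sub_eq_iff_eq_add'] using h1

theorem IsTop.isPolydifferential {m : ℕ} {C : MultiOp 𝕜 A m} (hC : P.IsTop C) :
    IsPolydifferential C := ⟨m, hC.isDiffOp⟩

end PoissonBracket

end Lifts

/-! ### Freezing an argument and moving it to the front -/

section PartialLift

variable {𝕜 A : Type*} [CommRing 𝕜] [CommRing A] [Algebra 𝕜 A]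

theorem insertNth_castSucc_comp_swap {α : Type*} {m : ℕ} (p : Fin m) (x : α) (w : Fin m → α) :
    (p.castSucc.insertNth x w : Fin (m + 1) → α) ∘ Equiv.swap p.castSucc p.succ =
      p.succ.insertNth x w := by
  have h2 := Fin.insertNth_apply_succAbove (α := fun _ => α) p.castSucc x w p
  have h3 := Fin.insertNth_apply_succAbove (α := fun _ => α) p.succ x w p
  rw [Fin.succAbove_castSucc_self] at h2
  rw [Fin.succAbove_succ_self] at h3
  ext j
  rcases eq_or_ne j p.castSucc with rfl | hj
  · simp [h2, h3]
  rcases eq_or_ne j p.succ with rfl | hj'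
  · simp
  rw [Function.comp_apply, Equiv.swap_apply_of_ne_of_ne hj hj']
  obtain ⟨i, rfl⟩ := Fin.exists_succAbove_eq hj
  have hi : i ≠ p := by rintro rfl; exact hj' (Fin.succAbove_castSucc_self _)
  have h4 : p.castSucc.succAbove i = p.succ.succAbove i := by
    rcases lt_or_gt_of_ne hi with h | h
    · rw [Fin.succAbove_castSucc_of_lt _ _ h, Fin.succAbove_succ_of_le _ _ h.le]
    · rw [Fin.succAbove_castSucc_of_le _ _ h.le, Fin.succAbove_succ_of_lt _ _ h]
  rw [Fin.insertNth_apply_succAbove, h4, Fin.insertNth_apply_succAbove]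

/-- Fix the last argument of a multilinear operator. -/
def MultiOp.fixLast {m : ℕ} (C : MultiOp 𝕜 A (m + 1)) (x : A) : MultiOp 𝕜 A m :=
  (LinearMap.applyₗ x).compMultilinearMap C.curryRight

theorem MultiOp.fixLast_apply {m : ℕ} (C : MultiOp 𝕜 A (m + 1)) (x : A) (w : Fin m → A) :
    C.fixLast x w = C (Fin.snoc w x) := rfl

/-- The sum of the operators obtained by applying `δ` to one of the arguments. -/
def MultiOp.sumComp {m : ℕ} (C : MultiOp 𝕜 A m) (δ : A →ₗ[𝕜] A) : MultiOp 𝕜 A m :=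
  ∑ k, C.compLinearMap (Function.update (fun _ => LinearMap.id) k δ)

theorem MultiOp.sumComp_apply {m : ℕ} (C : MultiOp 𝕜 A m) (δ : A →ₗ[𝕜] A) (v : Fin m → A) :
    C.sumComp δ v = ∑ k, C (Function.update v k (δ (v k))) := by
  simp only [sumComp, sum_apply, MultilinearMap.compLinearMap_apply]
  refine Finset.sum_congr rfl fun k _ => congrArg C ?_
  ext j
  rcases eq_or_ne j k with rfl | h <;> simp [*]

namespace PoissonBracket

variable {P : PoissonBracket 𝕜 A}

/-- Move `x` from the front to the end one place at a time: passing the `p`-th argument costs one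
bracket, and the differences telescope. -/
theorem Lifts.cons_sub_snoc {m : ℕ} {B : MultiOp 𝕜 A m} {C : MultiOp 𝕜 A (m + 1)}
    (h : P.Lifts B C) (x : A) (w : Fin m → A) :
    C (Fin.cons x w) - C (Fin.snoc w x) = B.sumComp (P.bracket x) w := by
  have h1 (p : Fin m) : C (p.castSucc.insertNth x w) - C (p.succ.insertNth x w) =
      B (Function.update w p (P.bracket x (w p))) := by
    rw [← insertNth_castSucc_comp_swap, h.swap, P.contract_insertNth]
  have h2 := Fin.sum_univ_succ fun p : Fin (m + 1) => C (p.insertNth x w)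
  rw [Fin.sum_univ_castSucc] at h2
  rw [MultiOp.sumComp_apply, ← Finset.sum_congr rfl fun p _ => h1 p, Finset.sum_sub_distrib]
  simp only [Fin.insertNth_zero', Fin.insertNth_last'] at h2
  linear_combination -h2

theorem Lifts.fixLast {m : ℕ} {B : MultiOp 𝕜 A (m + 1)} {C : MultiOp 𝕜 A (m + 2)}
    (h : P.Lifts B C) (x : A) : P.Lifts (B.fixLast x) (C.fixLast x) where
  derivation_first := by
    have h1 := (isDerivationIn_zero_iff C).1 h.derivation_first
    refine (isDerivationIn_zero_iff _).2 fun u f g => ?_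
    simpa only [MultiOp.fixLast_apply, Fin.cons_snoc_eq_snoc_cons] using h1 (Fin.snoc u x) f g
  swap k v := by
    have h1 := h.swap k.castSucc (Fin.snoc v x)
    rw [P.contract_snoc_castSucc] at h1
    rw [MultiOp.fixLast_apply, MultiOp.fixLast_apply, MultiOp.fixLast_apply, ← h1]
    congr 2
    ext j
    refine Fin.lastCases ?_ (fun j => ?_) j
    · rw [Function.comp_apply, Equiv.swap_apply_of_ne_of_ne, Fin.snoc_last, Fin.snoc_last]
      · exact (Fin.castSucc_lt_last _).ne'
      · rw [Fin.succ_castSucc]; exact (Fin.castSucc_lt_last _).ne'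
    · rw [Fin.snoc_castSucc, Function.comp_apply, Function.comp_apply, Fin.succ_castSucc,
        (Fin.castSucc_injective _).swap_apply, Fin.snoc_castSucc]

theorem IsTop.fixLast {m : ℕ} {C : MultiOp 𝕜 A (m + 1)} (h : P.IsTop C) (x : A) :
    P.IsTop (C.fixLast x) := by
  induction m with
  | zero => trivial
  | succ m ih =>
    obtain ⟨B, hB, hBC⟩ := h
    exact ⟨_, ih hB, hBC.fixLast x⟩

theorem contract_update_succAbove {m : ℕ} {i k : Fin m} (hi : i ≠ k) (v : Fin (m + 1) → A) (a : A) :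
    P.contract k (Function.update v (k.castSucc.succAbove i) a) =
      Function.update (P.contract k v) i a := by
  ext j
  rcases lt_or_gt_of_ne hi with h | h
  · rw [Fin.succAbove_castSucc_of_lt _ _ h]
    simp only [contract, Function.update_apply, Fin.ext_iff, Fin.lt_def, Fin.val_castSucc,
      Fin.val_succ] at h ⊢
    split_ifs <;> first | rfl | omega
  · rw [Fin.succAbove_castSucc_of_le _ _ h.le]
    simp only [contract, Function.update_apply, Fin.ext_iff, Fin.lt_def, Fin.val_castSucc,
      Fin.val_succ] at h ⊢
    split_ifs <;> first | rfl | omega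

theorem contract_of_ne {m : ℕ} {i k : Fin m} (hi : i ≠ k) (v : Fin (m + 1) → A) :
    P.contract k v i = v (k.castSucc.succAbove i) := by
  rcases lt_or_gt_of_ne hi with h | h
  · simp [contract, h, Fin.succAbove_castSucc_of_lt _ _ h]
  · simp [contract, h.not_gt, h.ne', Fin.succAbove_castSucc_of_le _ _ h.le]

/-- By Jacobi, `{x, ·}` is a derivation of the bracket, so its actions on the two contracted
arguments add up to its action on their bracket; the other terms match one by one. -/
theorem sum_contract_update {m : ℕ} (B : MultiOp 𝕜 A m) (k : Fin m) (x : A) (v : Fin (m + 1) → A) :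
    ∑ j, B (P.contract k (Function.update v j (P.bracket x (v j)))) =
      B.sumComp (P.bracket x) (P.contract k v) := by
  have hk : P.contract k v k = P.bracket (v k.castSucc) (v k.succ) := by simp [contract]
  rw [MultiOp.sumComp_apply, Fin.sum_univ_succAbove _ k.castSucc,
    Fintype.sum_eq_add_sum_compl k, Fintype.sum_eq_add_sum_compl k, ← add_assoc]
  congr 1
  · rw [Fin.succAbove_castSucc_self, contract_update_succ, contract_update_castSucc, hk,
      P.bracket_bracket x, MultilinearMap.map_update_add]
  · refine Finset.sum_congr rfl fun i hi => ?_
    have hi : i ≠ k := by simpa using hi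
    rw [contract_update_succAbove hi, contract_of_ne hi]

/-- The inner derivation `{x, ·}`, acting on all arguments at once, is compatible with permuting and
with contracting them, so it preserves the exchange relation. -/
theorem Lifts.sumComp_sub_swap {m : ℕ} {B : MultiOp 𝕜 A m} {C : MultiOp 𝕜 A (m + 1)}
    (h : P.Lifts B C) (x : A) (k : Fin m) (v : Fin (m + 1) → A) :
    C.sumComp (P.bracket x) v - C.sumComp (P.bracket x) (v ∘ Equiv.swap k.castSucc k.succ) =
      B.sumComp (P.bracket x) (P.contract k v) := by
  set s := Equiv.swap k.castSucc k.succ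
  have h1 : C.sumComp (P.bracket x) (v ∘ s) =
      ∑ j, C (Function.update v j (P.bracket x (v j)) ∘ s) := by
    rw [MultiOp.sumComp_apply,
      ← Equiv.sum_comp s fun j => C (Function.update v j (P.bracket x (v j)) ∘ s)]
    simp only [update_perm_comp, Function.comp_apply]
  rw [h1, MultiOp.sumComp_apply, ← Finset.sum_sub_distrib, ← sum_contract_update]
  exact Finset.sum_congr rfl fun j _ => h.swap k _

/-- `H` behaves like `(f_1, …) ↦ D (x, f_1, …)` for a lift `D` of `C`. -/
structure IsPartialLift (P : PoissonBracket 𝕜 A) {m : ℕ} (C : MultiOp 𝕜 A (m + 1)) (x : A)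
    (H : MultiOp 𝕜 A (m + 1)) : Prop where
  swap : ∀ (k : Fin m) (v : Fin (m + 1) → A),
    H v - H (v ∘ Equiv.swap k.castSucc k.succ) = C (Fin.cons x (P.contract k v))
  leibniz : ∀ (u : Fin m → A) (a b : A),
    H (Fin.cons (a * b) u) - a * H (Fin.cons b u) - b * H (Fin.cons a u) =
      P.bracket x b * C (Fin.cons a u) + P.bracket x a * C (Fin.cons b u)

/-- Here `G` stands for `D(…, x)`, and the added sum is the cost of carrying `x` to the front. In
the exchange relation this turns `C(…, x)` into `C(x, …)`; in the Leibniz rule, only the term with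
`{x, ·}` in the first slot leaves cross terms. -/
theorem Lifts.isPartialLift {m : ℕ} {B : MultiOp 𝕜 A m} {C : MultiOp 𝕜 A (m + 1)}
    (h : P.Lifts B C) {x : A} {G : MultiOp 𝕜 A (m + 1)} (hG : P.Lifts (C.fixLast x) G) :
    P.IsPartialLift C x (G + C.sumComp (P.bracket x)) where
  swap k v := by
    have h1 := hG.swap k v
    have h2 := h.sumComp_sub_swap x k v
    have h3 := h.cons_sub_snoc x (P.contract k v)
    simp only [add_apply, MultiOp.fixLast_apply] at h1 ⊢
    linear_combination h1 + h2 - h3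
  leibniz u a b := by
    have h1 := (isDerivationIn_zero_iff G).1 hG.derivation_first u a b
    have h2 := (isDerivationIn_zero_iff C).1 h.derivation_first
    simp only [add_apply, MultiOp.sumComp_apply, Fin.sum_univ_succ, Fin.cons_zero,
      Fin.cons_succ, Fin.update_cons_zero, ← Fin.cons_update, P.leibniz_right, C.cons_add, h1, h2,
      Finset.sum_add_distrib, ← Finset.mul_sum]
    ring

/-- The pairs `(x, H)` with `H` a partial lift of `C` for `x`. -/
def partialLifts (P : PoissonBracket 𝕜 A) {m : ℕ} (C : MultiOp 𝕜 A (m + 1)) :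
    Submodule 𝕜 (A × MultiOp 𝕜 A (m + 1)) where
  carrier := {p | P.IsPartialLift C p.1 p.2}
  zero_mem' := ⟨fun k v => by
      simpa using (C.map_coord_zero 0 (Fin.cons_zero _ _)).symm, fun u a b => by simp⟩
  add_mem' {p q} hp hq := ⟨fun k v => by
      have h1 := hp.swap k v
      have h2 := hq.swap k v
      simp only [Prod.fst_add, Prod.snd_add, add_apply, C.cons_add]
      linear_combination h1 + h2, fun u a b => by
      have h1 := hp.leibniz u a b
      have h2 := hq.leibniz u a b
      simp only [Prod.fst_add, Prod.snd_add, add_apply, map_add, LinearMap.add_apply]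
      linear_combination h1 + h2⟩
  smul_mem' c p hp := ⟨fun k v => by
      have h1 := hp.swap k v
      simp only [Prod.smul_fst, Prod.smul_snd, smul_apply, C.cons_smul]
      rw [← smul_sub, h1], fun u a b => by
      have h1 := hp.leibniz u a b
      simp only [Prod.smul_fst, Prod.smul_snd, smul_apply, map_smul,
        LinearMap.smul_apply, smul_mul_assoc, mul_smul_comm]
      rw [← smul_sub, ← smul_sub, h1, smul_add]⟩

end PoissonBracket

end PartialLift

/-! ### Permutations of argument lists -/

section ConsSwap

variable {α β : Type*}

theorem cons_comp_swap {m : ℕ} (a : α) (v : Fin m → α) (i j : Fin m) :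
    (Fin.cons a (v ∘ Equiv.swap i j) : Fin (m + 1) → α) =
      (Fin.cons a v : Fin (m + 1) → α) ∘ Equiv.swap i.succ j.succ := by
  ext k
  refine Fin.cases ?_ (fun k => ?_) k
  · rw [Function.comp_apply, Equiv.swap_apply_of_ne_of_ne (Fin.succ_ne_zero _).symm
      (Fin.succ_ne_zero _).symm]
    rfl
  · rw [Function.comp_apply, (Fin.succ_injective _).swap_apply]
    rfl

theorem cons_cons_comp_swap {m : ℕ} (a b : α) (v : Fin m → α) :
    (Fin.cons a (Fin.cons b v : Fin (m + 1) → α) : Fin (m + 2) → α) ∘ Equiv.swap 0 1 =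
      Fin.cons b (Fin.cons a v : Fin (m + 1) → α) := by
  ext k
  refine Fin.cases ?_ (fun k => ?_) k
  · rw [Function.comp_apply, Equiv.swap_apply_left]
    rfl
  · refine Fin.cases ?_ (fun k => ?_) k
    · rw [Fin.succ_zero_eq_one, Function.comp_apply, Equiv.swap_apply_right]
      rfl
    · rw [Function.comp_apply, Equiv.swap_apply_of_ne_of_ne (Fin.succ_ne_zero _)]
      · rfl
      · exact fun h => Fin.succ_ne_zero k (Fin.succ_injective _ h)

theorem update_comp_swap_zero {m : ℕ} (u : Fin (m + 1) → α) (j : Fin (m + 1)) (a : α) :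
    Function.update u j a ∘ Equiv.swap 0 j = Fin.cons a (Fin.tail (u ∘ Equiv.swap 0 j)) := by
  have h := update_perm_comp (Equiv.swap 0 j) u 0 a
  rw [Equiv.swap_apply_left] at h
  rw [h]
  conv_lhs => rw [← Fin.cons_self_tail (u ∘ Equiv.swap 0 j)]
  exact Fin.update_cons_zero _ _ _

theorem cons_comp_swap_zero_succ {m : ℕ} (a : α) (u : Fin m → α) (j : Fin m) :
    (Fin.cons a u : Fin (m + 1) → α) ∘ Equiv.swap 0 j.succ =
      Fin.cons (u j) (Function.update u j a) := by
  ext k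
  refine Fin.cases ?_ (fun k => ?_) k
  · simp
  · rcases eq_or_ne k j with rfl | h
    · simp
    · rw [Function.comp_apply, Equiv.swap_apply_of_ne_of_ne (Fin.succ_ne_zero _)]
      · simp [h]
      · exact fun h' => h (Fin.succ_injective _ h')

/-- A function invariant under exchanging adjacent arguments is invariant under all
permutations. -/
theorem comp_perm_eq_of_comp_swap_eq {m : ℕ} {F : (Fin (m + 1) → α) → β}
    (hF : ∀ (k : Fin m) v, F (v ∘ Equiv.swap k.castSucc k.succ) = F v)
    (σ : Equiv.Perm (Fin (m + 1))) (v : Fin (m + 1) → α) : F (v ∘ σ) = F v := by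
  have hσ : σ ∈ Submonoid.closure
      (Set.range fun i : Fin m => Equiv.swap i.castSucc i.succ) := by
    rw [Equiv.Perm.mclosure_swap_castSucc_succ]; trivial
  induction hσ using Submonoid.closure_induction generalizing v with
  | mem x hx => obtain ⟨k, rfl⟩ := hx; exact hF k v
  | one => rfl
  | mul x y _ _ hx hy =>
    rw [Equiv.Perm.coe_mul, ← Function.comp_assoc, hy, hx]

/-- If `F` does not depend on the order of the arguments after the first one, then moving each of
the arguments to the front in turn and summing gives a symmetric function. -/
theorem sum_comp_swap_zero_comp_perm [AddCommMonoid β] {m : ℕ} {F : (Fin (m + 1) → α) → β}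
    (hF : ∀ a u (τ : Equiv.Perm (Fin m)), F (Fin.cons a (u ∘ τ)) = F (Fin.cons a u))
    (σ : Equiv.Perm (Fin (m + 1))) (v : Fin (m + 1) → α) :
    ∑ k, F ((v ∘ σ) ∘ Equiv.swap 0 k) = ∑ k, F (v ∘ Equiv.swap 0 k) := by
  -- A permutation fixing `0` only permutes the tail, where `F` is symmetric.
  have key (τ : Equiv.Perm (Fin (m + 1))) (hτ : τ 0 = 0) (w : Fin (m + 1) → α) :
      F (w ∘ τ) = F w := by
    obtain ⟨⟨p, e⟩, rfl⟩ := Equiv.Perm.decomposeFin.symm.surjective τ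
    rw [Equiv.Perm.decomposeFin_symm_apply_zero] at hτ
    subst hτ
    have h : w ∘ Equiv.Perm.decomposeFin.symm (0, e) = Fin.cons (w 0) (Fin.tail w ∘ e) := by
      ext k
      refine Fin.cases ?_ (fun k => ?_) k
      · simp
      · simp [Fin.tail]
    rw [h, hF, Fin.cons_self_tail]
  rw [← Equiv.sum_comp σ fun k => F (v ∘ Equiv.swap 0 k)]
  refine Finset.sum_congr rfl fun k _ => ?_
  -- Both rearrangements put `v (σ k)` in front, so they differ by a permutation fixing `0`.
  rw [← key ((Equiv.swap 0 (σ k))⁻¹ * (σ * Equiv.swap 0 k)) (by simp) (v ∘ Equiv.swap 0 (σ k))]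
  congr 1
  ext i
  simp

end ConsSwap

/-! ### Symmetries of the defect in the first two arguments -/

section Correction

variable {𝕜 A : Type*} [CommRing 𝕜] [CommRing A] [Algebra 𝕜 A]

namespace PoissonBracket

variable {P : PoissonBracket 𝕜 A}

/-- The operator `(f_0, …, f_m) ↦ C (f_0, …, {f_k, f_{k+1}}, …, f_m)`. -/
def contractOp (P : PoissonBracket 𝕜 A) {m : ℕ} (k : Fin m) (C : MultiOp 𝕜 A m) :
    MultiOp 𝕜 A (m + 1) :=
  MultilinearMap.mk' (fun v => C (P.contract k v))
    (fun v i x y => by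
      rcases eq_or_ne i k.castSucc with rfl | hi
      · simp [contract_update_castSucc]
      · obtain ⟨j, rfl⟩ := Fin.exists_succAbove_eq hi
        rcases eq_or_ne j k with rfl | hj
        · simp [Fin.succAbove_castSucc_self, contract_update_succ]
        · simp [contract_update_succAbove hj])
    (fun v i c x => by
      rcases eq_or_ne i k.castSucc with rfl | hi
      · simp [contract_update_castSucc]
      · obtain ⟨j, rfl⟩ := Fin.exists_succAbove_eq hi
        rcases eq_or_ne j k with rfl | hj
        · simp [Fin.succAbove_castSucc_self, contract_update_succ]
        · simp [contract_update_succAbove hj])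

/-- `D` satisfies the requirements on a lift of `C`, except the one on exchanging the first two
arguments; it satisfies however the Leibniz rule for the second argument that this would imply. -/
structure IsPreLift (P : PoissonBracket 𝕜 A) {m : ℕ} (C : MultiOp 𝕜 A (m + 1))
    (D : MultiOp 𝕜 A (m + 2)) : Prop where
  derivation_first : ∀ (v : Fin (m + 1) → A) (f g : A),
    D (Fin.cons (f * g) v) = f * D (Fin.cons g v) + g * D (Fin.cons f v)
  swap : ∀ (k : Fin m) (f : A) (v : Fin (m + 1) → A),
    D (Fin.cons f v) - D (Fin.cons f (v ∘ Equiv.swap k.castSucc k.succ)) =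
      C (Fin.cons f (P.contract k v))
  leibniz_second : ∀ (u : Fin m → A) (g a b : A),
    D (Fin.cons g (Fin.cons (a * b) u)) - a * D (Fin.cons g (Fin.cons b u)) -
        b * D (Fin.cons g (Fin.cons a u)) =
      P.bracket g b * C (Fin.cons a u) + P.bracket g a * C (Fin.cons b u)

/-- The failure of `D` to satisfy the requirement on exchanging the first two arguments. -/
def defect (P : PoissonBracket 𝕜 A) {m : ℕ} (C : MultiOp 𝕜 A (m + 1)) (D : MultiOp 𝕜 A (m + 2)) :
    MultiOp 𝕜 A (m + 2) :=
  D - D.domDomCongr (Equiv.swap 0 1) - P.contractOp 0 C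

theorem defect_cons_cons {m : ℕ} (C : MultiOp 𝕜 A (m + 1)) (D : MultiOp 𝕜 A (m + 2)) (f g : A)
    (u : Fin m → A) : P.defect C D (Fin.cons f (Fin.cons g u)) =
      D (Fin.cons f (Fin.cons g u)) - D (Fin.cons g (Fin.cons f u)) -
        C (Fin.cons (P.bracket f g) u) := by
  rw [← contract_cons_zero, ← cons_cons_comp_swap f g u]
  rfl

theorem MultiOp.cons_neg {m : ℕ} (C : MultiOp 𝕜 A (m + 1)) (u : Fin m → A) (x : A) :
    C (Fin.cons (-x) u) = -C (Fin.cons x u) := by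
  simpa using C.cons_smul u (-1) x

theorem defect_antisymm {m : ℕ} (C : MultiOp 𝕜 A (m + 1)) (D : MultiOp 𝕜 A (m + 2)) (f g : A)
    (u : Fin m → A) : P.defect C D (Fin.cons f (Fin.cons g u)) =
      -P.defect C D (Fin.cons g (Fin.cons f u)) := by
  rw [defect_cons_cons, defect_cons_cons, P.bracket_skew f g, MultiOp.cons_neg]
  ring

namespace IsPreLift

variable {m : ℕ} {B : MultiOp 𝕜 A m} {C : MultiOp 𝕜 A (m + 1)} {D : MultiOp 𝕜 A (m + 2)}

/-- The cross terms of `D` in its second argument cancel those of `C({ab, g}, …)`. -/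
theorem defect_leibniz (hB : P.Lifts B C) (h : P.IsPreLift C D) (v : Fin (m + 1) → A) (a b : A) :
    P.defect C D (Fin.cons (a * b) v) =
      a * P.defect C D (Fin.cons b v) + b * P.defect C D (Fin.cons a v) := by
  rw [← Fin.cons_self_tail v]
  have h1 := h.derivation_first (Fin.cons (v 0) (Fin.tail v)) a b
  have h2 := h.leibniz_second (Fin.tail v) (v 0) a b
  have h3 := (isDerivationIn_zero_iff C).1 hB.derivation_first (Fin.tail v)
  simp only [defect_cons_cons, P.leibniz_left, C.cons_add, h3]
  linear_combination h1 - h2 - C (Fin.cons a (Fin.tail v)) * P.bracket_skew (v 0) b -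
    C (Fin.cons b (Fin.tail v)) * P.bracket_skew (v 0) a

/-- An adjacent exchange in the tail, with contracted tail `w`, changes the defect by `C(f, g, w) -
C(g, f, w) - B({f, g}, w)`, which vanishes because `C` lifts `B`. -/
theorem defect_comp_perm (hB : P.Lifts B C) (h : P.IsPreLift C D) (f g : A) (u : Fin m → A)
    (σ : Equiv.Perm (Fin m)) : P.defect C D (Fin.cons f (Fin.cons g (u ∘ σ))) =
      P.defect C D (Fin.cons f (Fin.cons g u)) := by
  cases m with
  | zero => rw [Subsingleton.elim (u ∘ σ) u]
  | succ m =>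
    refine comp_perm_eq_of_comp_swap_eq
      (F := fun u => P.defect C D (Fin.cons f (Fin.cons g u))) (fun k u => ?_) σ u
    have h1 (f g : A) := h.swap k.succ f (Fin.cons g u)
    simp only [Fin.castSucc_succ, ← cons_comp_swap, contract_cons_succ] at h1
    have h2 := hB.swap 0 (Fin.cons f (Fin.cons g (P.contract k u)))
    have h3 := hB.swap k.succ (Fin.cons (P.bracket f g) u)
    rw [Fin.castSucc_zero, Fin.succ_zero_eq_one, cons_cons_comp_swap, contract_cons_zero] at h2
    rw [contract_cons_succ, Fin.castSucc_succ, ← cons_comp_swap] at h3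
    simp only [defect_cons_cons]
    linear_combination h1 g f - h1 f g - h2 + h3

/-- Exchanging the second and third arguments of `D` turns the cyclic sum into one of `C(f, {g, x},
…) - C({g, x}, f, …)`, that is, of `B({f, {g, x}}, …)`, and Jacobi applies. -/
theorem defect_cyclic (hB : P.Lifts B C) (h : P.IsPreLift C D) (f g x : A) (u : Fin m → A)
    (j : Fin m) : P.defect C D (Fin.cons f (Fin.cons g (Function.update u j x))) +
      P.defect C D (Fin.cons g (Fin.cons x (Function.update u j f))) +
      P.defect C D (Fin.cons x (Fin.cons f (Function.update u j g))) = 0 := by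
  cases m with
  | zero => exact j.elim0
  | succ m =>
    -- Symmetry in the tail reduces the claim to the case where slot `j` is third overall.
    have key (a b c : A) : P.defect C D (Fin.cons a (Fin.cons b (Function.update u j c))) =
        P.defect C D (Fin.cons a (Fin.cons b (Fin.cons c (Fin.tail (u ∘ Equiv.swap 0 j))))) := by
      rw [← h.defect_comp_perm hB a b _ (Equiv.swap 0 j), update_comp_swap_zero]
    rw [key, key, key]
    set w := Fin.tail (u ∘ Equiv.swap 0 j)
    have h1 (a b c : A) := h.swap 0 a (Fin.cons b (Fin.cons c w))
    simp only [Fin.castSucc_zero, Fin.succ_zero_eq_one, cons_cons_comp_swap, contract_cons_zero]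
      at h1
    have h2 (a b c : A) := hB.swap 0 (Fin.cons a (Fin.cons (P.bracket b c) w))
    simp only [Fin.castSucc_zero, Fin.succ_zero_eq_one, cons_cons_comp_swap, contract_cons_zero]
      at h2
    have h3 : B (Fin.cons (P.bracket f (P.bracket g x)) w) +
        B (Fin.cons (P.bracket g (P.bracket x f)) w) +
        B (Fin.cons (P.bracket x (P.bracket f g)) w) = 0 := by
      rw [← B.cons_add, ← B.cons_add, P.jacobi]
      exact B.map_coord_zero 0 (Fin.cons_zero _ _)
    simp only [defect_cons_cons]
    linear_combination h1 f g x + h1 g x f + h1 x f g + h2 f g x + h2 g x f + h2 x f g + h3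

end IsPreLift

end PoissonBracket

end Correction

/-! ### Existence of lifts, given a retraction onto derivations -/

section Existence

/-- An `A`-linear retraction of the `𝕜`-linear endomorphisms of `A` onto the derivations. -/
structure DerivationRetraction (𝕜 A : Type*) [CommRing 𝕜] [CommRing A] [Algebra 𝕜 A] where
  /-- the underlying linear map -/
  toLinearMap : (A →ₗ[𝕜] A) →ₗ[A] (A →ₗ[𝕜] A)
  leibniz : ∀ H f g, toLinearMap H (f * g) = f * toLinearMap H g + g * toLinearMap H f
  apply_derivation : ∀ δ : A →ₗ[𝕜] A, (∀ f g, δ (f * g) = f * δ g + g * δ f) → toLinearMap δ = δ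

section Ring

variable {𝕜 A : Type*} [CommRing 𝕜] [CommRing A] [Algebra 𝕜 A]

/-- The operator `(x, v) ↦ K v x`. -/
def MultiOp.ofEnd {n : ℕ} (K : MultilinearMap 𝕜 (fun _ : Fin n => A) (A →ₗ[𝕜] A)) :
    MultiOp 𝕜 A (n + 1) :=
  LinearMap.uncurryLeft (M := fun _ => A)
    { toFun := fun x => (LinearMap.applyₗ x).compMultilinearMap K
      map_add' := fun x y => by ext; simp
      map_smul' := fun c x => by ext; simp }

theorem MultiOp.ofEnd_cons {n : ℕ} (K : MultilinearMap 𝕜 (fun _ : Fin n => A) (A →ₗ[𝕜] A)) (x : A)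
    (v : Fin n → A) : MultiOp.ofEnd K (Fin.cons x v) = K v x := by
  simp [ofEnd]

/-- Exchange the roles of the arguments of a linear family of multilinear operators. -/
def MultiOp.flip {n : ℕ} (H : A →ₗ[𝕜] MultiOp 𝕜 A n) :
    MultilinearMap 𝕜 (fun _ : Fin n => A) (A →ₗ[𝕜] A) where
  toFun v :=
    { toFun := fun x => H x v
      map_add' := fun x y => by simp
      map_smul' := fun c x => by simp }
  map_update_add' v i x y := by ext; simp
  map_update_smul' v i c x := by ext; simp

theorem MultiOp.flip_apply {n : ℕ} (H : A →ₗ[𝕜] MultiOp 𝕜 A n) (v : Fin n → A) (x : A) :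
    MultiOp.flip H v x = H x v := rfl

namespace PoissonBracket

variable {P : PoissonBracket 𝕜 A}

/-- Read each partial-lift relation as an identity between endomorphisms in the variable `x` and
apply the retraction. The right sides are `A`-combinations of derivations in `x`, so they are fixed;
`A`-linearity is what lets the coefficients `a`, `b` pass through in the Leibniz rule. -/
theorem exists_isPreLift (ret : DerivationRetraction 𝕜 A) {m : ℕ} {B : MultiOp 𝕜 A m}
    {C : MultiOp 𝕜 A (m + 1)} (hB : P.Lifts B C) (H : A →ₗ[𝕜] MultiOp 𝕜 A (m + 1))
    (hH : ∀ x, P.IsPartialLift C x (H x)) : ∃ D, P.IsPreLift C D := by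
  set K := MultiOp.flip H
  set E := MultiOp.flip C.curryLeft
  have hC := (isDerivationIn_zero_iff C).1 hB.derivation_first
  have hE (w : Fin m → A) : ret.toLinearMap (E w) = E w :=
    ret.apply_derivation _ fun f g => hC w f g
  set ad : A →ₗ[𝕜] A →ₗ[𝕜] A := P.bracket.flip
  have had (b : A) : ret.toLinearMap (ad b) = ad b :=
    ret.apply_derivation _ fun f g => P.leibniz_left f g b
  refine ⟨MultiOp.ofEnd ((ret.toLinearMap.restrictScalars 𝕜).compMultilinearMap K),
    fun v f g => ?_, fun k f v => ?_, fun u g a b => ?_⟩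
  · simp only [MultiOp.ofEnd_cons]
    exact ret.leibniz _ f g
  · have h1 : K v - K (v ∘ Equiv.swap k.castSucc k.succ) = E (P.contract k v) :=
      LinearMap.ext fun x => (hH x).swap k v
    have h2 := congrArg (fun L => ret.toLinearMap L f) h1
    simp only [map_sub, hE] at h2
    simp only [MultiOp.ofEnd_cons]
    exact h2
  · have h1 : K (Fin.cons (a * b) u) - a • K (Fin.cons b u) - b • K (Fin.cons a u) =
        C (Fin.cons a u) • ad b + C (Fin.cons b u) • ad a := by
      ext x
      have h2 := (hH x).leibniz u a b
      simp only [K, ad, LinearMap.sub_apply, LinearMap.add_apply, LinearMap.smul_apply, smul_eq_mul,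
        LinearMap.flip_apply, MultiOp.flip_apply]
      linear_combination h2
    have h2 := congrArg (fun L => ret.toLinearMap L g) h1
    simp only [map_sub, map_add, map_smul, had, LinearMap.sub_apply, LinearMap.add_apply,
      LinearMap.smul_apply, smul_eq_mul] at h2
    simp only [ad, LinearMap.flip_apply] at h2
    simp only [MultiOp.ofEnd_cons, LinearMap.compMultilinearMap_apply,
      LinearMap.restrictScalars_apply]
    linear_combination h2

/-- `T` averages `R` over which argument follows the first. It is symmetric in all arguments after
the first, so subtracting it keeps the later exchange relations, and its antisymmetrization in the
first two arguments is `R`. -/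
theorem IsPreLift.exists_lifts {m : ℕ} {B : MultiOp 𝕜 A m} {C : MultiOp 𝕜 A (m + 1)}
    {D : MultiOp 𝕜 A (m + 2)} (hB : P.Lifts B C) (h : P.IsPreLift C D) (c : 𝕜)
    (hc : c * (m + 2) = 1) : ∃ D', P.Lifts C D' := by
  set R := P.defect C D
  set T : MultiOp 𝕜 A (m + 2) :=
    c • ∑ k : Fin (m + 1), R.domDomCongr (Equiv.swap (0 : Fin (m + 1)).succ k.succ)
  have hT (f : A) (v : Fin (m + 1) → A) :
      T (Fin.cons f v) = c • ∑ k, R (Fin.cons f (v ∘ Equiv.swap 0 k)) := by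
    simp only [T, smul_apply, sum_apply, cons_comp_swap]
    rfl
  refine ⟨D - T, (isDerivationIn_zero_iff _).2 fun v a b => ?_, fun k v => ?_⟩
  · simp only [sub_apply, hT, h.derivation_first, R, h.defect_leibniz hB, Finset.sum_add_distrib,
      ← Finset.mul_sum, smul_add, mul_sub, mul_smul_comm]
    ring
  · obtain ⟨f, v, rfl⟩ : ∃ f u, v = Fin.cons f u := ⟨_, _, (Fin.cons_self_tail v).symm⟩
    refine Fin.cases ?_ (fun k => ?_) k
    · obtain ⟨g, u, rfl⟩ : ∃ f u, v = Fin.cons f u := ⟨_, _, (Fin.cons_self_tail v).symm⟩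
      have h1 (f g : A) : T (Fin.cons f (Fin.cons g u)) = c • (R (Fin.cons f (Fin.cons g u)) +
          ∑ j, R (Fin.cons f (Fin.cons (u j) (Function.update u j g)))) := by
        rw [hT, Fin.sum_univ_succ]
        simp only [cons_comp_swap_zero_succ, Equiv.swap_self, Equiv.coe_refl, Function.comp_id]
      have h2 : T (Fin.cons f (Fin.cons g u)) - T (Fin.cons g (Fin.cons f u)) =
          R (Fin.cons f (Fin.cons g u)) := by
        -- Each of the `m` tail arguments contributes one copy of `R` by cyclicity, and antisymmetry
        -- of the leading term gives two more; hence the normalization `1 / (m + 2)`.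
        have h3 (j : Fin m) : R (Fin.cons f (Fin.cons (u j) (Function.update u j g))) =
            R (Fin.cons g (Fin.cons (u j) (Function.update u j f))) +
              R (Fin.cons f (Fin.cons g u)) := by
          have h4 := h.defect_cyclic hB f g (u j) u j
          rw [Function.update_eq_self, defect_antisymm C D (u j)] at h4
          linear_combination -h4
        have h5 : R (Fin.cons g (Fin.cons f u)) = -R (Fin.cons f (Fin.cons g u)) :=
          defect_antisymm C D g f u
        rw [h1 f g, h1 g f, Finset.sum_congr rfl fun j _ => h3 j, Finset.sum_add_distrib,
          Finset.sum_const, h5, Finset.card_univ, Fintype.card_fin]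
        simp only [Algebra.smul_def]
        have h6 := congrArg (algebraMap 𝕜 A) hc
        simp only [map_mul, map_add, map_natCast, map_ofNat, map_one] at h6
        linear_combination R (Fin.cons f (Fin.cons g u)) * h6
      rw [Fin.castSucc_zero, Fin.succ_zero_eq_one, cons_cons_comp_swap, contract_cons_zero]
      simp only [R, defect_cons_cons] at h2
      simp only [sub_apply]
      linear_combination -h2
    · rw [Fin.castSucc_succ, ← cons_comp_swap, contract_cons_succ]
      have h1 := h.swap k f v
      have h2 : T (Fin.cons f (v ∘ Equiv.swap k.castSucc k.succ)) = T (Fin.cons f v) := by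
        rw [hT, hT]
        congr 1
        exact sum_comp_swap_zero_comp_perm (F := fun v => R (Fin.cons f v))
          (fun a u τ => h.defect_comp_perm hB f a u τ) _ v
      simp only [sub_apply]
      linear_combination h1 + h2

end PoissonBracket

end Ring

section Field

variable {𝕜 A : Type*} [Field 𝕜] [CommRing A] [Algebra 𝕜 A]

namespace PoissonBracket

variable {P : PoissonBracket 𝕜 A}

/-- The pairs `(x, H)` form a vector space that surjects onto `A`, and over a field a surjection has
a linear section. -/
theorem exists_linear_partialLift {m : ℕ} {C : MultiOp 𝕜 A (m + 1)}
    (h : ∀ x, ∃ H, P.IsPartialLift C x H) :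
    ∃ H : A →ₗ[𝕜] MultiOp 𝕜 A (m + 1), ∀ x, P.IsPartialLift C x (H x) := by
  set π : P.partialLifts C →ₗ[𝕜] A := LinearMap.fst 𝕜 _ _ ∘ₗ (P.partialLifts C).subtype
  have hπ : LinearMap.range π = ⊤ := by
    refine LinearMap.range_eq_top.2 fun x => ?_
    obtain ⟨H, hH⟩ := h x
    exact ⟨⟨(x, H), hH⟩, rfl⟩
  obtain ⟨σ, hσ⟩ := π.exists_rightInverse_of_surjective hπ
  refine ⟨LinearMap.snd 𝕜 _ _ ∘ₗ (P.partialLifts C).subtype ∘ₗ σ, fun x => ?_⟩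
  have h1 : P.IsPartialLift C (π (σ x)) (σ x).1.2 := (σ x).2
  rwa [show π (σ x) = x from LinearMap.congr_fun hσ x] at h1

theorem IsTop.exists_lifts [CharZero 𝕜] (ret : DerivationRetraction 𝕜 A) {m : ℕ}
    {C : MultiOp 𝕜 A m} (hC : P.IsTop C) : ∃ D, P.Lifts C D := by
  induction m with
  -- A unary lift only has to be a derivation, so zero serves.
  | zero => exact ⟨0, fun v f g => by simp, fun k => k.elim0⟩
  | succ m ih =>
    obtain ⟨B, -, hBC⟩ := id hC
    obtain ⟨H, hH⟩ := exists_linear_partialLift (P := P) (C := C) fun x => by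
      obtain ⟨G, hG⟩ := ih (hC.fixLast x)
      exact ⟨_, hBC.isPartialLift hG⟩
    obtain ⟨D, hD⟩ := exists_isPreLift ret hBC H hH
    refine hD.exists_lifts hBC ((m + 2 : 𝕜)⁻¹) (inv_mul_cancel₀ ?_)
    exact_mod_cast (Nat.succ_ne_zero (m + 1) : ((m + 2 : ℕ) ≠ 0))

end PoissonBracket

end Field

end Existence

/-! ### From lifts back to coherent families, and uniqueness -/

section Families

variable {𝕜 A : Type*} [CommRing 𝕜] [CommRing A] [Algebra 𝕜 A]

theorem extendFamily_castSucc {n : ℕ} (C : ∀ k : Fin n, MultiOp 𝕜 A k) (D : MultiOp 𝕜 A n)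
    (k : Fin n) : extendFamily C D k.castSucc = C k :=
  Fin.snoc_castSucc (α := fun k : Fin (n + 1) => MultiOp 𝕜 A k) D C k

theorem extendFamily_mk {n : ℕ} (C : ∀ k : Fin n, MultiOp 𝕜 A k) (D : MultiOp 𝕜 A n) {m : ℕ}
    (hm : m < n) (hm' : m < n + 1) : extendFamily C D ⟨m, hm'⟩ = C ⟨m, hm⟩ :=
  extendFamily_castSucc C D ⟨m, hm⟩

theorem extendFamily_last {n : ℕ} (C : ∀ k : Fin n, MultiOp 𝕜 A k) (D : MultiOp 𝕜 A n) :
    extendFamily C D (Fin.last n) = D :=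
  Fin.snoc_last (α := fun k : Fin (n + 1) => MultiOp 𝕜 A k) D C

namespace PoissonBracket

variable {P : PoissonBracket 𝕜 A}

theorem IsCoherent.lifts {n : ℕ} {C : ∀ k : Fin n, MultiOp 𝕜 A k} (h : P.IsCoherent C) {m : ℕ}
    (hm : m + 1 < n) : P.Lifts (C ⟨m, (Nat.lt_succ_self m).trans hm⟩) (C ⟨m + 1, hm⟩) :=
  ⟨h.derivation_first ⟨m + 1, hm⟩ m.succ_pos, h.swap m hm⟩

theorem IsCoherent.isTop {n : ℕ} {C : ∀ k : Fin n, MultiOp 𝕜 A k} (h : P.IsCoherent C) {m : ℕ}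
    (hm : m < n) : P.IsTop (C ⟨m, hm⟩) := by
  induction m with
  | zero => trivial
  | succ m ih => exact ⟨_, ih _, h.lifts hm⟩

theorem isCoherent_extendFamily_zero (C : ∀ k : Fin 0, MultiOp 𝕜 A k) (D : MultiOp 𝕜 A 0) :
    P.IsCoherent (extendFamily C D) where
  polydifferential k := ⟨0, fun i => by
    have := k.isLt
    have := i.isLt
    omega⟩
  derivation_first k hk := by
    have := k.isLt
    omega
  swap m hm := by omega

theorem isCoherent_extendFamily_succ {n : ℕ} {C : ∀ k : Fin (n + 1), MultiOp 𝕜 A k}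
    (hC : P.IsCoherent C) (D : MultiOp 𝕜 A (n + 1)) :
    P.IsCoherent (extendFamily C D) ↔ P.Lifts (C (Fin.last n)) D := by
  constructor
  · intro h
    have h1 := h.lifts (Nat.lt_succ_self (n + 1))
    rw [extendFamily_mk C D n.lt_succ_self] at h1
    have h2 : extendFamily C D ⟨n + 1, Nat.lt_succ_self (n + 1)⟩ = D := extendFamily_last C D
    rwa [h2] at h1
  · intro h
    refine ⟨fun k => ?_, fun k hk => ?_, fun m hm k f => ?_⟩
    · refine Fin.lastCases ?_ (fun k => ?_) k
      · rw [extendFamily_last]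
        exact IsTop.isPolydifferential ⟨_, hC.isTop n.lt_succ_self, h⟩
      · rw [extendFamily_castSucc]
        exact hC.polydifferential k
    · induction k using Fin.lastCases with
      | last => rw [extendFamily_last]; exact h.derivation_first
      | cast k => rw [extendFamily_castSucc]; exact hC.derivation_first k hk
    · rcases Nat.lt_succ_iff_lt_or_eq.1 hm with hm' | hm'
      · rw [extendFamily_mk C D hm', extendFamily_mk C D ((Nat.lt_succ_self m).trans hm')]
        exact hC.swap m hm' k f
      · obtain rfl : m = n := by omega
        have h1 : extendFamily C D ⟨m + 1, hm⟩ = D := extendFamily_last C D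
        rw [h1, extendFamily_mk C D m.lt_succ_self]
        exact h.swap k f

/-- The contraction terms cancel in a difference of lifts; adjacent transpositions generate all
permutations, and symmetry carries the Leibniz rule from the first slot to the others. -/
theorem Lifts.lifts_iff {m : ℕ} {B : MultiOp 𝕜 A m} {D : MultiOp 𝕜 A (m + 1)} (h : P.Lifts B D)
    (D' : MultiOp 𝕜 A (m + 1)) : P.Lifts B D' ↔ IsSymmetricMultiderivation (D' - D) := by
  constructor
  · intro h'
    have hsymm (σ : Equiv.Perm (Fin (m + 1))) (v : Fin (m + 1) → A) :
        (D' - D) (v ∘ σ) = (D' - D) v :=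
      comp_perm_eq_of_comp_swap_eq (fun k v => by
        simp only [sub_apply]
        linear_combination h.swap k v - h'.swap k v) σ v
    refine ⟨hsymm, fun i v f g => ?_⟩
    have h1 (a : A) : (D' - D) (Function.update v i a) =
        (D' - D) (Function.update (v ∘ Equiv.swap 0 i) 0 a) := by
      rw [← update_perm_comp, hsymm, Equiv.swap_apply_left]
    have h2 := h.derivation_first (v ∘ Equiv.swap 0 i) f g
    have h3 := h'.derivation_first (v ∘ Equiv.swap 0 i) f g
    simp only [h1, sub_apply]
    linear_combination h3 - h2
  · rintro ⟨hsymm, hder⟩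
    refine ⟨fun v f g => ?_, fun k v => ?_⟩
    · have h1 := hder 0 v f g
      have h2 := h.derivation_first v f g
      simp only [sub_apply] at h1
      linear_combination h1 + h2
    · have h1 := hsymm (Equiv.swap k.castSucc k.succ) v
      have h2 := h.swap k v
      simp only [sub_apply] at h1
      linear_combination h2 - h1

end PoissonBracket

end Families

/-- Extension of coherent families, and uniqueness up to symmetric multiderivations, over any
algebra with a linear retraction of its endomorphisms onto its derivations. -/
theorem PoissonBracket.IsCoherent.exists_extension_and_unique {𝕜 A : Type*} [Field 𝕜] [CharZero 𝕜]
    [CommRing A] [Algebra 𝕜 A] (ret : DerivationRetraction 𝕜 A) {P : PoissonBracket 𝕜 A} {n : ℕ}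
    {C : ∀ k : Fin n, MultiOp 𝕜 A k} (hC : P.IsCoherent C) :
    (∃ D, P.IsCoherent (extendFamily C D)) ∧ ∀ D, P.IsCoherent (extendFamily C D) →
      ∀ D', P.IsCoherent (extendFamily C D') ↔ IsSymmetricMultiderivation (D' - D) := by
  cases n with
  | zero =>
    refine ⟨⟨0, isCoherent_extendFamily_zero _ _⟩, fun D _ D' =>
      ⟨fun _ => ⟨fun σ v => ?_, fun i => i.elim0⟩, fun _ => isCoherent_extendFamily_zero _ _⟩⟩
    rw [Subsingleton.elim (v ∘ σ) v]
  | succ n =>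
    simp only [isCoherent_extendFamily_succ hC]
    exact ⟨(hC.isTop n.lt_succ_self).exists_lifts ret, fun D hD D' => hD.lifts_iff D'⟩

/-! ### Hadamard's lemma with smooth coefficients -/

section Hadamard

/-- Differentiate under the integral: each derivative in `y` brings out a factor `t` and replaces
`k` by its derivative, so the induction runs over all `j` and all targets. With `E` in `Type`, the
new target `E →L[ℝ] F` stays in the universe of `F`. -/
theorem contDiff_integral_pow_smul_comp_smul.{u} {E : Type} [NormedAddCommGroup E]
    [NormedSpace ℝ E] [FiniteDimensional ℝ E] (n : ℕ) {F : Type u} [NormedAddCommGroup F]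
    [NormedSpace ℝ F] [CompleteSpace F] (j : ℕ) {k : E → F} (hk : ContDiff ℝ ∞ k) :
    ContDiff ℝ n fun y => ∫ t in (0 : ℝ)..1, t ^ j • k (t • y) := by
  have hcont {G : Type u} [NormedAddCommGroup G] [NormedSpace ℝ G] (j : ℕ) {k : E → G}
      (hk : Continuous k) : Continuous fun p : E × ℝ => p.2 ^ j • k (p.2 • p.1) := by fun_prop
  induction n generalizing F j k with
  | zero =>
    rw [Nat.cast_zero, contDiff_zero]
    exact intervalIntegral.continuous_parametric_intervalIntegral_of_continuous'
      (hcont j hk.continuous) 0 1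
  | succ n ih =>
    have hk' : ContDiff ℝ ∞ (fderiv ℝ k) := hk.fderiv_right (by simp)
    rw [Nat.cast_succ, contDiff_succ_iff_hasFDerivAt]
    refine ⟨_, ih (j + 1) hk', fun y₀ => ?_⟩
    have hc := hcont j hk.continuous
    have hc' := hcont (j + 1) hk'.continuous
    obtain ⟨c, hcb⟩ := ((isCompact_closedBall y₀ 1).prod (isCompact_Icc (a := (0 : ℝ))
      (b := 1))).exists_bound_of_continuousOn hc'.continuousOn
    refine intervalIntegral.hasFDerivAt_integral_of_dominated_of_fderiv_le (𝕜 := ℝ)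
      (F := fun y t => t ^ j • k (t • y)) (F' := fun y t => t ^ (j + 1) • fderiv ℝ k (t • y))
      (bound := fun _ => c)
      (Metric.ball_mem_nhds y₀ one_pos) (.of_forall fun y => ?_) ?_ ?_ ?_ ?_ ?_
    · exact (hc.comp (Continuous.prodMk_right y)).aestronglyMeasurable
    · exact (hc.comp (Continuous.prodMk_right y₀)).intervalIntegrable _ _
    · exact (hc'.comp (Continuous.prodMk_right y₀)).aestronglyMeasurable
    · refine .of_forall fun t ht y hy => hcb (y, t) ⟨Metric.ball_subset_closedBall hy, ?_⟩
      rw [Set.uIoc_of_le zero_le_one] at ht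
      exact Set.Ioc_subset_Icc_self ht
    · exact intervalIntegrable_const
    · refine .of_forall fun t _ y _ => ?_
      have h1 : HasFDerivAt (fun y : E => t • y) (t • ContinuousLinearMap.id ℝ E) y :=
        (hasFDerivAt_id y).const_smul t
      have h2 := ((hk.differentiable (by simp)) (t • y)).hasFDerivAt.comp y h1
      exact (h2.const_smul (t ^ j)).congr_fderiv (by ext z; simp [pow_succ, smul_smul])

/-- Hadamard's lemma. -/
theorem ContDiff.exists_sub_eq_apply_sub.{u} {E : Type} [NormedAddCommGroup E]
    [NormedSpace ℝ E] [FiniteDimensional ℝ E] {F : Type u} [NormedAddCommGroup F]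
    [NormedSpace ℝ F] [CompleteSpace F] {f : E → F} (hf : ContDiff ℝ ∞ f) (y₀ : E) :
    ∃ G : E → E →L[ℝ] F, ContDiff ℝ ∞ G ∧ G y₀ = fderiv ℝ f y₀ ∧
      ∀ y, f y - f y₀ = G y (y - y₀) := by
  set h : E → F := fun z => f (y₀ + z)
  have hh : ContDiff ℝ ∞ h := hf.comp (contDiff_const.add contDiff_id)
  have hh' : ContDiff ℝ ∞ (fderiv ℝ h) := hh.fderiv_right (by simp)
  -- The average of the derivative along the segment from the base point.
  set G : E → E →L[ℝ] F := fun z => ∫ t in (0 : ℝ)..1, t ^ 0 • fderiv ℝ h (t • z)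
  have hG : ContDiff ℝ ∞ G :=
    contDiff_infty.2 fun n => contDiff_integral_pow_smul_comp_smul n 0 hh'
  refine ⟨fun y => G (y - y₀), hG.comp (contDiff_id.sub contDiff_const), ?_, fun y => ?_⟩
  · simp [G, h, fderiv_comp_add_left]
  · have hc : Continuous fun t : ℝ => fderiv ℝ h (t • (y - y₀)) :=
      hh'.continuous.comp (continuous_id.smul continuous_const)
    simp only [G, pow_zero, one_smul]
    rw [ContinuousLinearMap.intervalIntegral_apply (hc.intervalIntegrable _ _)]
    have h1 (t : ℝ) : HasDerivAt (fun t : ℝ => h (t • (y - y₀)))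
        (fderiv ℝ h (t • (y - y₀)) (y - y₀)) t := by
      have h2 : HasDerivAt (fun t : ℝ => t • (y - y₀)) ((1 : ℝ) • (y - y₀)) t :=
        (hasDerivAt_id t).smul_const _
      rw [one_smul] at h2
      exact ((hh.differentiable (by simp)) _).hasFDerivAt.comp_hasDerivAt t h2
    rw [intervalIntegral.integral_eq_sub_of_hasDerivAt (fun t _ => h1 t)
      ((hc.clm_apply continuous_const).intervalIntegrable _ _)]
    simp [h]

end Hadamard

/-! ### The retraction onto derivations for smooth functions -/

section Retraction

open scoped Topology

variable {𝕜 : Type*} [RCLike 𝕜] {d : ℕ} {M : Type*} [TopologicalSpace M]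
  [ChartedSpace (EuclideanSpace ℝ (Fin d)) M]

/-- The partial derivative of `f` in the direction of the `i`-th coordinate of the chart at `c`. -/
noncomputable def chartPartial (c : M) (i : Fin d) (f : M → 𝕜) (x : M) : 𝕜 :=
  fderiv ℝ (f ∘ (extChartAt (𝓡 d) c).symm) (extChartAt (𝓡 d) c x) (EuclideanSpace.single i 1)

/-- The `i`-th coordinate function with values in `𝕜`. -/
noncomputable def coordFun (𝕜 : Type*) [RCLike 𝕜] {d : ℕ} (i : Fin d)
    (y : EuclideanSpace ℝ (Fin d)) : 𝕜 := (y i : 𝕜)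

theorem contDiff_coordFun (i : Fin d) : ContDiff ℝ ∞ (coordFun 𝕜 i) :=
  (RCLike.ofRealCLM (K := 𝕜)).contDiff.comp (EuclideanSpace.proj (𝕜 := ℝ) i).contDiff

theorem chartPartial_congr {c x : M} (hx : x ∈ (extChartAt (𝓡 d) c).source) (i : Fin d)
    {f g : M → 𝕜} (h : f =ᶠ[𝓝 x] g) : chartPartial c i f x = chartPartial c i g x := by
  have h1 := continuousAt_extChartAt_symm' (I := 𝓡 d) hx
  have h2 : f ∘ (extChartAt (𝓡 d) c).symm =ᶠ[𝓝 (extChartAt (𝓡 d) c x)]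
      g ∘ (extChartAt (𝓡 d) c).symm := by
    rw [ContinuousAt, (extChartAt (𝓡 d) c).left_inv hx] at h1
    exact h.comp_tendsto h1
  rw [chartPartial, chartPartial, h2.fderiv_eq]

theorem chartPartial_const (c x : M) (i : Fin d) (a : 𝕜) :
    chartPartial c i (fun _ => a) x = 0 := by
  have h : (fun _ : M => a) ∘ (extChartAt (𝓡 d) c).symm = fun _ => a := rfl
  rw [chartPartial, h, fderiv_fun_const]
  rfl

variable [IsManifold (𝓡 d) ∞ M]

theorem contDiffAt_comp_extChartAt_symm {c x : M} (hx : x ∈ (extChartAt (𝓡 d) c).source)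
    {f : M → 𝕜} (hf : ContMDiff (𝓡 d) 𝓘(ℝ, 𝕜) ∞ f) :
    ContDiffAt ℝ ∞ (f ∘ (extChartAt (𝓡 d) c).symm) (extChartAt (𝓡 d) c x) := by
  have h1 := hf.comp_contMDiffOn (contMDiffOn_extChartAt_symm (I := 𝓡 d) (n := ∞) c)
  exact (contMDiffOn_iff_contDiffOn.1 h1).contDiffAt
    ((isOpen_extChartAt_target c).mem_nhds ((extChartAt (𝓡 d) c).map_source hx))

theorem contMDiffAt_chartPartial {c x : M} (hx : x ∈ (extChartAt (𝓡 d) c).source) (i : Fin d)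
    {f : M → 𝕜} (hf : ContMDiff (𝓡 d) 𝓘(ℝ, 𝕜) ∞ f) :
    ContMDiffAt (𝓡 d) 𝓘(ℝ, 𝕜) ∞ (chartPartial c i f) x := by
  have h1 := (contDiffAt_comp_extChartAt_symm hx hf).fderiv_right (m := ∞) (by simp)
  have h2 := h1.clm_apply (contDiffAt_const (c := EuclideanSpace.single i (1 : ℝ)))
  have h3 : ContMDiffAt (𝓡 d) (𝓡 d) ∞ (extChartAt (𝓡 d) c) x :=
    contMDiffAt_extChartAt' (by rwa [extChartAt_source] at hx)
  exact h2.contMDiffAt.comp x h3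

theorem chartPartial_add {c x : M} (hx : x ∈ (extChartAt (𝓡 d) c).source) (i : Fin d)
    (f g : SmoothFun 𝕜 d M) :
    chartPartial c i (f + g : SmoothFun 𝕜 d M) x = chartPartial c i f x + chartPartial c i g x := by
  have hf := (contDiffAt_comp_extChartAt_symm hx f.contMDiff).differentiableAt (by simp)
  have hg := (contDiffAt_comp_extChartAt_symm hx g.contMDiff).differentiableAt (by simp)
  rw [chartPartial, chartPartial, chartPartial, ← add_apply, ← fderiv_add hf hg]
  rfl

theorem chartPartial_mul {c x : M} (hx : x ∈ (extChartAt (𝓡 d) c).source) (i : Fin d)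
    (f g : SmoothFun 𝕜 d M) : chartPartial c i (f * g : SmoothFun 𝕜 d M) x =
      f x * chartPartial c i g x + g x * chartPartial c i f x := by
  have hf := (contDiffAt_comp_extChartAt_symm hx f.contMDiff).differentiableAt (by simp)
  have hg := (contDiffAt_comp_extChartAt_symm hx g.contMDiff).differentiableAt (by simp)
  have h := fderiv_mul hf hg
  simp only [Function.comp_apply, (extChartAt (𝓡 d) c).left_inv hx] at h
  have h1 := congrArg (fun L => L (EuclideanSpace.single i (1 : ℝ))) h
  exact h1

theorem chartPartial_smul {c x : M} (hx : x ∈ (extChartAt (𝓡 d) c).source) (i : Fin d) (a : 𝕜)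
    (f : SmoothFun 𝕜 d M) :
    chartPartial c i (a • f : SmoothFun 𝕜 d M) x = a * chartPartial c i f x := by
  have hf := (contDiffAt_comp_extChartAt_symm hx f.contMDiff).differentiableAt (by simp)
  have h := fderiv_const_smul hf a
  exact congrArg (fun L => L (EuclideanSpace.single i (1 : ℝ))) h

/-- The smooth function `χ · (G ∘ φ)` for the chart `φ` at `c`, a cutoff function `χ` supported in
its domain and a smooth function `G` of the coordinates. -/
noncomputable def chartLift (c : M) (χ : C^∞⟮𝓡 d, M; 𝓘(ℝ, ℝ), ℝ⟯)
    (hχ : tsupport χ ⊆ (extChartAt (𝓡 d) c).source) {G : EuclideanSpace ℝ (Fin d) → 𝕜}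
    (hG : ContDiff ℝ ∞ G) : SmoothFun 𝕜 d M :=
  ⟨fun x => χ x • G (extChartAt (𝓡 d) c x), contMDiff_of_tsupport fun x hx => by
    have hx' := hχ (tsupport_smul_subset_left χ _ hx)
    have h3 : ContMDiffAt (𝓡 d) (𝓡 d) ∞ (extChartAt (𝓡 d) c) x :=
      contMDiffAt_extChartAt' (by rwa [extChartAt_source] at hx')
    exact χ.contMDiff.contMDiffAt.smul (hG.contMDiff.contMDiffAt.comp x h3)⟩

theorem chartLift_apply (c : M) (χ : C^∞⟮𝓡 d, M; 𝓘(ℝ, ℝ), ℝ⟯)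
    (hχ : tsupport χ ⊆ (extChartAt (𝓡 d) c).source) {G : EuclideanSpace ℝ (Fin d) → 𝕜}
    (hG : ContDiff ℝ ∞ G) (x : M) :
    chartLift c χ hχ hG x = χ x * G (extChartAt (𝓡 d) c x) :=
  RCLike.real_smul_eq_coe_mul _ _

/-- Hadamard's lemma integrates along segments, which may leave the chart's image. The bump function
`θ` makes the local expression of `f` globally smooth without changing it near `p`, and is the same
for all `f`. -/
theorem exists_local_hadamard {c p : M} (hp : p ∈ (extChartAt (𝓡 d) c).source) :
    ∃ θ : EuclideanSpace ℝ (Fin d) → 𝕜, ContDiff ℝ ∞ θ ∧ θ (extChartAt (𝓡 d) c p) = 1 ∧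
      ∀ f : SmoothFun 𝕜 d M, ∃ g : Fin d → EuclideanSpace ℝ (Fin d) → 𝕜,
        (∀ i, ContDiff ℝ ∞ (g i)) ∧ (∀ i, g i (extChartAt (𝓡 d) c p) = chartPartial c i f p) ∧
        ∀ x ∈ (extChartAt (𝓡 d) c).source, θ (extChartAt (𝓡 d) c x) * f x - f p =
          ∑ i, (coordFun 𝕜 i (extChartAt (𝓡 d) c x) - coordFun 𝕜 i (extChartAt (𝓡 d) c p)) *
            g i (extChartAt (𝓡 d) c x) := by
  set φ := extChartAt (𝓡 d) c
  have hopen : IsOpen φ.target := isOpen_extChartAt_target c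
  obtain ⟨r, hr, hball⟩ := Metric.nhds_basis_closedBall.mem_iff.1
    (hopen.mem_nhds (φ.map_source hp))
  let b : ContDiffBump (φ p) := ⟨r / 2, r, half_pos hr, half_lt_self hr⟩
  have hb1 : (b : EuclideanSpace ℝ (Fin d) → ℝ) =ᶠ[𝓝 (φ p)] 1 := b.eventuallyEq_one
  refine ⟨fun y => (b y : 𝕜), (RCLike.ofRealCLM (K := 𝕜)).contDiff.comp b.contDiff,
    by simp [hb1.self_of_nhds], fun f => ?_⟩
  set F : EuclideanSpace ℝ (Fin d) → 𝕜 := fun y => b y • f (φ.symm y)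
  have hF : ContDiff ℝ ∞ F := by
    rw [← contMDiff_iff_contDiff]
    refine contMDiff_of_tsupport fun y hy => ?_
    have hy' : y ∈ φ.target := by
      have := tsupport_smul_subset_left b _ hy
      rw [b.tsupport_eq] at this
      exact hball this
    have h1 := contDiffAt_comp_extChartAt_symm (φ.map_target hy') f.contMDiff
    have h2 : φ (φ.symm y) = y := φ.right_inv hy'
    rw [show extChartAt (𝓡 d) c (φ.symm y) = y from h2] at h1
    exact (b.contDiff.contDiffAt.smul h1).contMDiffAt
  obtain ⟨G, hG, hG0, hGF⟩ := hF.exists_sub_eq_apply_sub (φ p)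
  have hFp : F (φ p) = f p := by simp [F, hb1.self_of_nhds, φ.left_inv hp]
  refine ⟨fun i y => G y (EuclideanSpace.single i 1), fun i => hG.clm_apply contDiff_const,
    fun i => ?_, fun x hx => ?_⟩
  · have h1 : F =ᶠ[𝓝 (φ p)] f ∘ φ.symm := by
      filter_upwards [hb1] with y hy
      simp [F, hy]
    change G (φ p) _ = _
    rw [hG0, h1.fderiv_eq]
    rfl
  · have h1 := hGF (φ x)
    have h2 : φ x - φ p = ∑ i, (φ x - φ p) i • EuclideanSpace.single i (1 : ℝ) := by
      have := (EuclideanSpace.basisFun (Fin d) ℝ).sum_repr (φ x - φ p)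
      simpa using this.symm
    have h3 : F (φ x) = b (φ x) * f x := by
      simp only [F, φ.left_inv hx]
      exact RCLike.real_smul_eq_coe_mul _ _
    rw [← h3, ← hFp, h1]
    conv_lhs => rw [h2]
    simp only [map_sum, map_smul]
    refine Finset.sum_congr rfl fun i _ => ?_
    rw [RCLike.real_smul_eq_coe_mul]
    simp [coordFun]

omit [IsManifold (𝓡 d) ∞ M] in
theorem smoothFun_sum_apply {ι : Type*} (s : Finset ι) (f : ι → SmoothFun 𝕜 d M) (x : M) :
    (∑ i ∈ s, f i) x = ∑ i ∈ s, f i x :=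
  map_sum (AddMonoidHom.mk' (fun f : SmoothFun 𝕜 d M => f x) fun _ _ => rfl) f s

/-- A derivation at a point is determined by its values on the coordinate functions. -/
theorem pointDerivation_eq_sum {c p : M} (hp : p ∈ (extChartAt (𝓡 d) c).source)
    {χ : C^∞⟮𝓡 d, M; 𝓘(ℝ, ℝ), ℝ⟯} (hχ : tsupport χ ⊆ (extChartAt (𝓡 d) c).source)
    (hχp : χ =ᶠ[𝓝 p] 1) {v : SmoothFun 𝕜 d M →ₗ[𝕜] 𝕜}
    (hv : ∀ f g, v (f * g) = f p * v g + g p * v f) (f : SmoothFun 𝕜 d M) :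
    v f = ∑ i, chartPartial c i f p * v (chartLift c χ hχ (contDiff_coordFun i)) := by
  obtain ⟨θ, hθ, hθp, H⟩ := exists_local_hadamard (𝕜 := 𝕜) hp
  set y₀ := extChartAt (𝓡 d) c p
  have hχ1 : χ p = 1 := hχp.self_of_nhds
  set u : SmoothFun 𝕜 d M := chartLift c χ hχ (contDiff_const (c := (1 : 𝕜)))
  have hu (x : M) : u x = χ x := by simp [u, chartLift_apply]
  set t : SmoothFun 𝕜 d M := chartLift c χ hχ hθ
  set X : Fin d → SmoothFun 𝕜 d M := fun i => chartLift c χ hχ (contDiff_coordFun i)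
  -- Apply `v` to the Hadamard expansion multiplied by `χ ^ 2`, which makes every factor a global
  -- smooth function. Terms with both factors differentiated away from a zero at `p` drop out; the
  -- cutoffs leave `v t` and `v u` to be eliminated by testing on `1` and then on `u`.
  have key (f : SmoothFun 𝕜 d M) : v f + f p * (v t - v u) =
      ∑ i, chartPartial c i f p * (v (X i) - coordFun 𝕜 i y₀ * v u) := by
    obtain ⟨g, hg, hgp, hgf⟩ := H f
    have h1 : u * (t * f - f p • u) =
        ∑ i, (X i - coordFun 𝕜 i y₀ • u) * chartLift c χ hχ (hg i) := by
      ext x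
      rw [smoothFun_sum_apply]
      change u x * (t x * f x - f p * u x) =
        ∑ i, (X i x - coordFun 𝕜 i y₀ * u x) * chartLift c χ hχ (hg i) x
      simp only [hu, t, X, chartLift_apply]
      by_cases hx : x ∈ (extChartAt (𝓡 d) c).source
      · have h2 := congrArg (fun a => (χ x : 𝕜) * χ x * a) (hgf x hx)
        simp only [Finset.mul_sum] at h2
        rw [show ((χ x : 𝕜) * (χ x * θ (extChartAt (𝓡 d) c x) * f x - f p * χ x)) =
          (χ x : 𝕜) * χ x * (θ (extChartAt (𝓡 d) c x) * f x - f p) by ring, h2]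
        exact Finset.sum_congr rfl fun i _ => by ring
      · have h2 : χ x = 0 := image_eq_zero_of_notMem_tsupport fun h => hx (hχ h)
        simp [h2]
    have hup : u p = 1 := by simp [hu, hχ1]
    have htp : t p = 1 := (chartLift_apply c χ hχ hθ p).trans (by rw [hχ1, hθp]; simp)
    have h2 := congrArg v h1
    have h3 : (t * f - f p • u) p = 0 := by
      change t p * f p - f p * u p = 0
      rw [hup, htp]; ring
    have h4 (i : Fin d) : (X i - coordFun 𝕜 i y₀ • u) p = 0 := by
      change X i p - coordFun 𝕜 i y₀ * u p = 0
      rw [hup]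
      simp [X, chartLift_apply, hχ1, y₀]
    have h5 (i : Fin d) : chartLift c χ hχ (hg i) p = chartPartial c i f p := by
      rw [chartLift_apply, hgp, hχ1]
      simp
    rw [hv, h3, hup, map_sub, map_smul, hv, htp, map_sum] at h2
    simp only [hv, h4, h5, map_sub, map_smul, smul_eq_mul] at h2
    simp only [zero_mul, zero_add] at h2
    linear_combination h2
  have hv1 : v 1 = 0 := by
    have h := hv 1 1
    simp at h
    exact h
  have htu : v t - v u = 0 := by
    have h := key 1
    have h1 (i : Fin d) : chartPartial c i (1 : SmoothFun 𝕜 d M) p = 0 :=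
      chartPartial_const c p i (1 : 𝕜)
    rw [Finset.sum_eq_zero fun i _ => by rw [h1, zero_mul], hv1, zero_add] at h
    simpa using h
  -- Since `u` is `1` near `p`, its partial derivatives vanish there.
  have hvu : v u = 0 := by
    have h := key u
    have h1 (i : Fin d) : chartPartial c i u p = 0 := by
      rw [← chartPartial_const c p i (1 : 𝕜)]
      refine chartPartial_congr hp i ?_
      filter_upwards [hχp] with x hx
      simp [hu, hx]
    rwa [Finset.sum_eq_zero fun i _ => by rw [h1, zero_mul], htu, mul_zero, add_zero] at h
  have h := key f
  rw [htu, mul_zero, add_zero] at h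
  simpa only [hvu, mul_zero, sub_zero] using h

variable [T2Space M] [SigmaCompactSpace M]

/-- The smooth functions on a manifold admit a linear retraction onto the derivations. -/
theorem nonempty_derivationRetraction_smoothFun :
    Nonempty (DerivationRetraction 𝕜 (SmoothFun 𝕜 d M)) := by
  obtain ⟨ρ, hρ⟩ := SmoothPartitionOfUnity.exists_isSubordinate_chartAt_source (𝓡 d) M
  have hρ' (c : M) : tsupport (ρ c) ⊆ (extChartAt (𝓡 d) c).source := by
    rw [extChartAt_source]; exact hρ c
  -- The coordinates of the chart at `c` must be extended to `M` unchanged near every point where `ρ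
  -- c` is nonzero.
  have hcut (c : M) : ∃ χ : C^∞⟮𝓡 d, M; 𝓘(ℝ, ℝ), ℝ⟯,
      tsupport χ ⊆ (extChartAt (𝓡 d) c).source ∧ ∀ x ∈ tsupport (ρ c), χ =ᶠ[𝓝 x] 1 := by
    have : LocallyCompactSpace M :=
      Manifold.locallyCompact_of_finiteDimensional (𝓡 d)
    obtain ⟨χ, h0, h1, -⟩ := exists_contMDiffMap_zero_one_nhds_of_isClosed (𝓡 d) (n := ⊤)
      (isOpen_extChartAt_source (I := 𝓡 d) c).isClosed_compl (isClosed_tsupport (ρ c))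
      (Set.disjoint_compl_left_iff_subset.2 (hρ' c))
    refine ⟨χ, fun x hx => ?_, fun x hx => h1.filter_mono (nhds_le_nhdsSet hx)⟩
    by_contra hx'
    exact notMem_tsupport_iff_eventuallyEq.2 (h0.filter_mono (nhds_le_nhdsSet hx')) hx
  choose χ hχ hχ1 using hcut
  set X : M → Fin d → SmoothFun 𝕜 d M := fun c i => chartLift c (χ c) (hχ c) (contDiff_coordFun i)
  -- In each chart, the vector field whose components are the values of `H` on the cut-off
  -- coordinates; its dependence on `H` is visibly `A`-linear.
  set T : (SmoothFun 𝕜 d M →ₗ[𝕜] SmoothFun 𝕜 d M) → SmoothFun 𝕜 d M → M → M → 𝕜 :=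
    fun H f c x => ∑ i, chartPartial c i f x * H (X c i) x
  set Q : (SmoothFun 𝕜 d M →ₗ[𝕜] SmoothFun 𝕜 d M) → SmoothFun 𝕜 d M → SmoothFun 𝕜 d M :=
    fun H f => ⟨fun x => ∑ᶠ c, ρ c x • T H f c x, ρ.contMDiff_finsum_smul fun c x hx =>
      ContMDiffAt.sum fun i _ =>
        (contMDiffAt_chartPartial (hρ' c hx) i f.contMDiff).mul (H (X c i)).contMDiff.contMDiffAt⟩
  have hQ (H f x) : Q H f x = ∑ c ∈ ρ.finsupport x, (ρ c x : 𝕜) * T H f c x := by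
    simp only [← RCLike.real_smul_eq_coe_mul]
    exact (ρ.sum_finsupport_smul_eq_finsum x (T H f)).symm
  have hsrc {x c : M} (hc : c ∈ ρ.finsupport x) : x ∈ (extChartAt (𝓡 d) c).source :=
    hρ' c (subset_tsupport _ ((ρ.mem_finsupport x).1 hc))
  have hadd (H f g) : Q H (f + g) = Q H f + Q H g := by
    ext x
    change Q H (f + g) x = Q H f x + Q H g x
    simp only [hQ, ← Finset.sum_add_distrib, ← mul_add]
    refine Finset.sum_congr rfl fun c hc => ?_
    simp only [T, chartPartial_add (hsrc hc), add_mul, Finset.sum_add_distrib]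
  have hsmul (H) (a : 𝕜) (f) : Q H (a • f) = a • Q H f := by
    ext x
    change Q H (a • f) x = a * Q H f x
    simp only [hQ, Finset.mul_sum]
    refine Finset.sum_congr rfl fun c hc => ?_
    simp only [T, chartPartial_smul (hsrc hc), Finset.mul_sum]
    exact Finset.sum_congr rfl fun i _ => by ring
  let L (H) : SmoothFun 𝕜 d M →ₗ[𝕜] SmoothFun 𝕜 d M :=
    { toFun := Q H, map_add' := hadd H, map_smul' := hsmul H }
  refine ⟨⟨⟨⟨L, fun H K => ?_⟩, fun a H => ?_⟩, fun H f g => ?_, fun δ hδ => ?_⟩⟩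
  · ext f x
    change Q (H + K) f x = Q H f x + Q K f x
    simp only [hQ, ← Finset.sum_add_distrib, ← mul_add, T]
    rfl
  · ext f x
    change Q (a • H) f x = a x * Q H f x
    simp only [hQ, Finset.mul_sum, T]
    refine Finset.sum_congr rfl fun c hc => Finset.sum_congr rfl fun i _ => ?_
    change (ρ c x : 𝕜) * (chartPartial c i f x * (a x * H (X c i) x)) = _
    ring
  · ext x
    change Q H (f * g) x = f x * Q H g x + g x * Q H f x
    simp only [hQ, Finset.mul_sum, ← Finset.sum_add_distrib]
    refine Finset.sum_congr rfl fun c hc => ?_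
    simp only [T, chartPartial_mul (hsrc hc), Finset.mul_sum, ← Finset.sum_add_distrib]
    exact Finset.sum_congr rfl fun i _ => by ring
  · ext f x
    change Q δ f x = δ f x
    have h1 (c : M) (hc : c ∈ ρ.finsupport x) : T δ f c x = δ f x := by
      let ev : SmoothFun 𝕜 d M →ₗ[𝕜] 𝕜 :=
        { toFun := fun f => f x, map_add' := fun _ _ => rfl, map_smul' := fun _ _ => rfl }
      exact (pointDerivation_eq_sum (hsrc hc) (hχ c)
        (hχ1 c x (subset_tsupport _ ((ρ.mem_finsupport x).1 hc))) (v := ev ∘ₗ δ)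
        (fun f g => congrArg (fun h : SmoothFun 𝕜 d M => h x) (hδ f g)) f).symm
    rw [hQ, Finset.sum_congr rfl fun c hc => by rw [h1 c hc], ← Finset.sum_mul]
    have h2 := ρ.sum_finsupport x (Set.mem_univ x)
    have h3 : ∑ c ∈ ρ.finsupport x, (ρ c x : 𝕜) = 1 := by
      exact_mod_cast congrArg (RCLike.ofReal (K := 𝕜)) h2
    rw [h3, one_mul]

end Retraction

theorem mainTheorem7 {𝕜 : Type*} [RCLike 𝕜] (d : ℕ) {M : Type*} [TopologicalSpace M] [T2Space M]
    [SecondCountableTopology M] [ChartedSpace (EuclideanSpace ℝ (Fin d)) M]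
    [IsManifold (𝓡 d) ∞ M] (P : PoissonBracket 𝕜 (SmoothFun 𝕜 d M))
    (n : ℕ) (C : ∀ k : Fin n, MultiOp 𝕜 (SmoothFun 𝕜 d M) k) (hC : P.IsCoherent C) :
    (∃ D : MultiOp 𝕜 (SmoothFun 𝕜 d M) n, P.IsCoherent (extendFamily C D)) ∧
      ∀ D : MultiOp 𝕜 (SmoothFun 𝕜 d M) n, P.IsCoherent (extendFamily C D) →
        ∀ D' : MultiOp 𝕜 (SmoothFun 𝕜 d M) n,
          P.IsCoherent (extendFamily C D') ↔ IsSymmetricMultiderivation (D' - D) := by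
  -- With second countability this gives the σ-compactness needed for partitions of unity.
  have : LocallyCompactSpace M := Manifold.locallyCompact_of_finiteDimensional (𝓡 d)
  obtain ⟨ret⟩ := nonempty_derivationRetraction_smoothFun (𝕜 := 𝕜) (d := d) (M := M)
  exact hC.exists_extension_and_unique ret
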